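/- Let $(k_n)_{n\ge 1}$ be a strictly increasing sequence of positive integers with $\sum_{n=1}^{\infty}\frac1{k_n}=+\infty$. Let $\mathcal H(\mathbb C)$ be the space of entire functions with the topology of uniform convergence on compact subsets of $\mathbb C$. For $n\ge 1$ and $z\in\mathbb C\setminus\{0\}$ let $T_{n,z}:\mathcal H(\mathbb C)\to\mathcal H(\mathbb C)$ be the operator $(T_{n,z}f)(w)=\frac{d^n}{dw^n}\bigl[f(zw)\bigr]=z^n f^{(n)}(zw)$. Then there exist an entire function $f$ and a set $J\subseteq\mathbb C\setminus\{0\}$ of full measure such that for every $z\in J$ the function $f$ is hypercyclic for the sequence $(T_{k_n,z})_{n\ge1}$, that is, the set $\{T_{k_n,z}f : n=1,2,\dots\}$ is dense in $\mathcal H(\mathbb C)$. Here a set $J\subseteq\mathbb C\setminus\{0\}$ is said to be of full measure if for every $\lambda>0$ the set $\{\theta\in[0,1) : \lambda e^{2\pi i\theta}\in J\}$ is Lebesgue measurable and has Lebesgue measure $1$. -/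

import Mathlib

open Set Filter Topology MeasureTheory

/-- The space of entire functions `ℂ → ℂ`, as a linear subspace of `C(ℂ, ℂ)`. It carries the subspace
topology of the compact-open topology, which is the topology of uniform convergence on compact
subsets of `ℂ`. -/
def entireFunctions : Submodule ℂ C(ℂ, ℂ) where
  carrier := {f | Differentiable ℂ (f : ℂ → ℂ)}
  add_mem' hf hg := Differentiable.add hf hg
  zero_mem' := differentiable_const (0 : ℂ)
  smul_mem' c _ hf := Differentiable.const_smul hf c

/-- An element of `entireFunctions` is differentiable on all of `ℂ`. -/
theorem entireFunctions_differentiable (f : entireFunctions) :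
    Differentiable ℂ (f.1 : ℂ → ℂ) := f.2

/-- The derivative of an entire function is entire. -/
theorem entireFunctions_differentiable_deriv (f : entireFunctions) :
    Differentiable ℂ (deriv (f.1 : ℂ → ℂ)) :=
  ((entireFunctions_differentiable f).contDiff (n := 2)).differentiable_deriv_two

/-- The differentiation operator `D f = f'` on the space of entire functions. -/
noncomputable def differentiationOp : entireFunctions →ₗ[ℂ] entireFunctions where
  toFun f := ⟨⟨deriv (f.1 : ℂ → ℂ), (entireFunctions_differentiable_deriv f).continuous⟩,
    entireFunctions_differentiable_deriv f⟩
  map_add' f g := by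
    ext z
    exact deriv_add (entireFunctions_differentiable f z) (entireFunctions_differentiable g z)
  map_smul' c f := by
    ext z
    exact deriv_const_smul c (entireFunctions_differentiable f z)

/-- The dilation operator `f ↦ f ∘ φ_w`, where `φ_w z = w * z`. -/
noncomputable def dilationOp (w : ℂ) : entireFunctions →ₗ[ℂ] entireFunctions where
  toFun f := ⟨⟨fun z => f.1 (w * z), f.1.continuous.comp (continuous_const.mul continuous_id)⟩,
    (entireFunctions_differentiable f).comp (differentiable_id.const_mul w)⟩
  map_add' _ _ := rfl
  map_smul' _ _ := rfl

/-- The operator `T_{n,w}`, `T_{n,w} f = D^n (f ∘ φ_w)`, that is `z ↦ w ^ n * f^{(n)} (w * z)`. -/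
noncomputable def dilatedDerivOp (n : ℕ) (w : ℂ) : entireFunctions →ₗ[ℂ] entireFunctions :=
  (differentiationOp ^ n).comp (dilationOp w)

/-- The set of hypercyclic vectors of a sequence of maps: the points `x` whose orbit
`{T_n x : n}` is dense. -/
def hypercyclicVectors {X : Type*} [TopologicalSpace X] (T : ℕ → X → X) : Set X :=
  {x | Dense (range fun n => T n x)}

/-- The set `J_r` of arcs of `J` with respect to `r`. -/
def arcs (J : Set ℂ) (r : ℝ) : Set ℝ :=
  {θ | θ ∈ Ico (0 : ℝ) 1 ∧ ∃ z ∈ J, z = (r : ℂ) * Complex.exp (2 * Real.pi * Complex.I * θ)}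

/-- `J ⊆ ℂ \ {0}` is of full measure: for every `r > 0` the set `J_r` is Lebesgue measurable (that
is, `NullMeasurableSet`) and has Lebesgue measure one. -/
def IsFullMeasure (J : Set ℂ) : Prop :=
  J ⊆ {0}ᶜ ∧ ∀ r : ℝ, 0 < r → NullMeasurableSet (arcs J r) volume ∧ volume (arcs J r) = 1

/-! Fix a polynomial `h`, write `I^m h` for its `m`-fold antiderivative, and let `z = r e^{2πiθ}`.
Then `z^m D^m (ρ^{-m} I^m h) = (r/ρ)^m e^{2πimθ} h`, which is close to `h` as soon as `r ∈ [ρ, ρ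
e^{c/m}]` and `mθ` is close to an integer. Take a sum of such terms with radii `ρ_{l+1} = ρ_l
e^{c/m_l}`. Divergence of `∑ 1/k_n`, inherited by arithmetic progressions of indices, lets finitely
many of these windows cover `[A⁻¹, A]`. If the exponents `m_l` are well spaced, the terms do not
interfere: those of lower order are differentiated away and those of higher order are factorially
small (`exists_approx_on_annulus`).

Arguments are handled by measure. The tolerance `c` does not depend on where the exponents start. By
the Riemann–Lebesgue lemma, for large `m` the set where `mθ` is near an integer takes at least a
fixed fraction `1 - q` of any given set of finite measure (`exists_measureReal_diff_nearOne_le`).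
Repeating the block for `h` at ever higher exponents leaves, for each fixed `r`, an uncaught set of
measure at most `q^b` after `b` rounds, hence a null set in the end (`measure_diff_iUnion_eq_zero`).

The function `f` is the sum of all blocks. A pairing function schedules every target polynomial
infinitely often, and each block is small enough not to spoil the earlier ones
(`exists_entire_approx`). Letting the targets approximate a dense sequence of entire functions gives
hypercyclicity. -/

/-! ### Asymptotic independence of dilated arguments -/

/-- The parameters `θ` for which `exp (2 π i m θ)` lies within `c` of `1`. -/
def nearOne (m : ℕ) (c : ℝ) : Set ℝ :=
  {θ | ‖Complex.exp (2 * Real.pi * Complex.I * m * θ) - 1‖ < c}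

theorem isOpen_nearOne (m : ℕ) (c : ℝ) : IsOpen (nearOne m c) :=
  isOpen_lt (by fun_prop) continuous_const

theorem integral_fourier_haar {n : ℤ} (hn : n ≠ 0) :
    ∫ x : AddCircle (1 : ℝ), fourier n x ∂AddCircle.haarAddCircle = 0 :=
  integral_eq_zero_of_add_right_eq_neg (fourier_add_half_inv_index hn one_pos)

/-- For `n ≠ 0` this is the Riemann–Lebesgue lemma for the indicator of `S` at frequency `-nm`; the
sign comes from the convention for the Fourier transform. -/
theorem tendsto_setIntegral_fourier {S : Set ℝ} (hS : MeasurableSet S) (n : ℤ) :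
    Tendsto (fun m : ℕ => ∫ θ in S, fourier n ((m * θ : ℝ) : AddCircle (1 : ℝ))) atTop
      (𝓝 ((volume.real S : ℂ) * ∫ x : AddCircle (1 : ℝ), fourier n x ∂AddCircle.haarAddCircle)) := by
  rcases eq_or_ne n 0 with rfl | hn
  · simp [Measure.real]
  · rw [integral_fourier_haar hn, mul_zero]
    have hc : Tendsto (fun m : ℕ => -((n : ℝ) * m)) atTop (cocompact ℝ) := by
      have h1 : Tendsto (fun m : ℕ => ‖-((n : ℝ) * m)‖) atTop atTop := by
        simp only [norm_neg, norm_mul, RCLike.norm_natCast]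
        exact tendsto_natCast_atTop_atTop.const_mul_atTop (by simpa using hn)
      exact tendsto_norm_atTop_iff_cobounded.1 h1 |>.mono_right Metric.cobounded_eq_cocompact.le
    refine ((Real.tendsto_integral_exp_smul_cocompact (S.indicator fun _ => (1 : ℂ))).comp
      hc).congr fun m => ?_
    rw [← integral_indicator hS]
    refine integral_congr_ae (Eventually.of_forall fun θ => ?_)
    by_cases hθ : θ ∈ S
    · simp only [indicator_of_mem hθ, fourier_coe_apply, Real.fourierChar_apply,
        Circle.smul_def, smul_eq_mul, mul_one]
      congr 1
      push_cast
      ring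
    · simp [indicator_of_notMem hθ]

/-- Fejér's mixing property: it is linear in `φ`, holds for characters, and passes to uniform limits
of trigonometric polynomials by a three-epsilon argument. -/
theorem tendsto_setIntegral_dilate {S : Set ℝ} (hS : MeasurableSet S) (hfin : volume S ≠ ⊤)
    (φ : C(AddCircle (1 : ℝ), ℂ)) :
    Tendsto (fun m : ℕ => ∫ θ in S, φ ((m * θ : ℝ) : AddCircle (1 : ℝ))) atTop
      (𝓝 ((volume.real S : ℂ) * ∫ x : AddCircle (1 : ℝ), φ x ∂AddCircle.haarAddCircle)) := by
  have hint : ∀ (ψ : C(AddCircle (1 : ℝ), ℂ)) (m : ℕ),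
      IntegrableOn (fun θ : ℝ => ψ ((m * θ : ℝ) : AddCircle (1 : ℝ))) S := fun ψ m =>
    Measure.integrableOn_of_bounded (M := ‖ψ‖) hfin
      (Continuous.aestronglyMeasurable (by
        exact ψ.continuous.comp ((AddCircle.continuous_mk' 1).comp (by fun_prop))))
      (Eventually.of_forall fun θ => ψ.norm_coe_le_norm _)
  have hinth : ∀ ψ : C(AddCircle (1 : ℝ), ℂ), Integrable ψ AddCircle.haarAddCircle := fun ψ =>
    ψ.continuous.integrable_of_hasCompactSupport (HasCompactSupport.of_compactSpace _)
  have hspan : ∀ ψ ∈ Submodule.span ℂ (range (@fourier (1 : ℝ))),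
      Tendsto (fun m : ℕ => ∫ θ in S, ψ ((m * θ : ℝ) : AddCircle (1 : ℝ))) atTop
        (𝓝 ((volume.real S : ℂ) * ∫ x : AddCircle (1 : ℝ), ψ x ∂AddCircle.haarAddCircle)) := by
    intro ψ hψ
    induction hψ using Submodule.span_induction with
    | mem ψ h =>
      obtain ⟨n, rfl⟩ := h
      exact tendsto_setIntegral_fourier hS n
    | zero => simp
    | add f g _ _ hf hg =>
      simp only [ContinuousMap.add_apply]
      rw [integral_add (hinth f) (hinth g), mul_add]
      exact (hf.add hg).congr fun m => (integral_add (hint f m) (hint g m)).symm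
    | smul a f _ hf =>
      simp only [ContinuousMap.smul_apply]
      rw [integral_smul, mul_smul_comm]
      exact (hf.const_smul a).congr fun m => (integral_smul _ _).symm
  rw [Metric.tendsto_atTop]
  intro ε hε
  set V : ℝ := volume.real S
  have hV : 0 ≤ V := measureReal_nonneg
  have hφ : φ ∈ closure (Submodule.span ℂ (range (@fourier (1 : ℝ))) : Set _) := by
    rw [← Submodule.topologicalClosure_coe, span_fourier_closure_eq_top]
    trivial
  obtain ⟨ψ, hψ, hd⟩ := Metric.mem_closure_iff.1 hφ (ε / (3 * (V + 1))) (by positivity)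
  obtain ⟨N, hN⟩ := Metric.tendsto_atTop.1 (hspan ψ hψ) (ε / 3) (by positivity)
  have hle : ∀ x, ‖φ x - ψ x‖ ≤ ε / (3 * (V + 1)) := fun x => by
    rw [← dist_eq_norm]; exact (ContinuousMap.dist_apply_le_dist x).trans hd.le
  have hsmall : ε / (3 * (V + 1)) * V < ε / 3 := by
    rw [div_mul_eq_mul_div, div_lt_div_iff₀ (by positivity) (by positivity)]
    nlinarith
  refine ⟨N, fun m hm => ?_⟩
  have h1 : dist (∫ θ in S, φ ((m * θ : ℝ) : AddCircle (1 : ℝ)))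
      (∫ θ in S, ψ ((m * θ : ℝ) : AddCircle (1 : ℝ))) < ε / 3 := by
    rw [dist_eq_norm, ← integral_sub (hint φ m) (hint ψ m)]
    exact (norm_setIntegral_le_of_norm_le_const hfin.lt_top fun θ _ => hle _).trans_lt hsmall
  have h2 : dist ((V : ℂ) * ∫ x : AddCircle (1 : ℝ), ψ x ∂AddCircle.haarAddCircle)
      ((V : ℂ) * ∫ x : AddCircle (1 : ℝ), φ x ∂AddCircle.haarAddCircle) < ε / 3 := by
    rw [dist_comm, dist_eq_norm, ← mul_sub, ← integral_sub (hinth φ) (hinth ψ), norm_mul, mul_comm,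
      Complex.norm_real, Real.norm_of_nonneg hV]
    refine lt_of_le_of_lt (mul_le_mul_of_nonneg_right ?_ hV) hsmall
    simpa using norm_integral_le_of_norm_le_const (μ := AddCircle.haarAddCircle)
      (Eventually.of_forall hle)
  have := dist_triangle4 (∫ θ in S, φ ((m * θ : ℝ) : AddCircle (1 : ℝ)))
    (∫ θ in S, ψ ((m * θ : ℝ) : AddCircle (1 : ℝ)))
    ((V : ℂ) * ∫ x : AddCircle (1 : ℝ), ψ x ∂AddCircle.haarAddCircle)
    ((V : ℂ) * ∫ x : AddCircle (1 : ℝ), φ x ∂AddCircle.haarAddCircle)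
  linarith [hN m hm]

/-- For large `m` the set `nearOne m c` meets every given set of finite measure in at least a fixed
proportion. -/
theorem exists_measureReal_diff_nearOne_le {c : ℝ} (hc : 0 < c) :
    ∃ q : ℝ, 0 ≤ q ∧ q < 1 ∧ ∀ S : Set ℝ, MeasurableSet S → volume S ≠ ⊤ →
      ∀ᶠ m : ℕ in atTop, volume.real (S \ nearOne m c) ≤ q * volume.real S := by
  -- A continuous tent that minorises the indicator of the arc of radius `c` around `1`; its mean
  -- `I` is the share captured in the limit.
  let b : AddCircle (1 : ℝ) → ℝ := fun x => max 0 (1 - ‖fourier 1 x - 1‖ / c)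
  have hbc : Continuous b := by
    have := (fourier (T := (1 : ℝ)) 1).continuous
    fun_prop
  have hb0 : ∀ x, 0 ≤ b x := fun x => le_max_left _ _
  have hb1 : ∀ x, b x ≤ 1 := fun x => max_le zero_le_one (by
    have : 0 ≤ ‖fourier 1 x - 1‖ / c := by positivity
    linarith)
  set I : ℝ := ∫ x, b x ∂AddCircle.haarAddCircle with hI
  have hIpos : 0 < I := by
    refine hbc.integral_pos_of_hasCompactSupport_nonneg_nonzero
      (HasCompactSupport.of_compactSpace _) hb0 (x := 0) ?_
    simp [b]
  have hI1 : I ≤ 1 := by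
    have h : ‖I‖ ≤ 1 := by
      simpa using norm_integral_le_of_norm_le_const (μ := AddCircle.haarAddCircle) (C := 1)
        (f := b) (Eventually.of_forall fun x => by
          rw [Real.norm_of_nonneg (hb0 x)]; exact hb1 x)
    exact (le_abs_self _).trans h
  -- Half of the limiting share `I` is given up, so that the bound holds for all large `m` and not
  -- only in the limit.
  refine ⟨1 - I / 2, by linarith, by linarith, fun S hS hfin => ?_⟩
  rcases eq_or_ne (volume.real S) 0 with h0 | h0
  · refine Eventually.of_forall fun m => ?_
    rw [h0, mul_zero, ← h0]
    exact measureReal_mono sdiff_subset hfin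
  have hV : 0 < volume.real S := lt_of_le_of_ne measureReal_nonneg h0.symm
  let φ : C(AddCircle (1 : ℝ), ℂ) := ⟨fun x => (b x : ℂ), by fun_prop⟩
  have ht := (Complex.continuous_re.tendsto _).comp (tendsto_setIntegral_dilate hS hfin φ)
  have hlim : ((volume.real S : ℂ) * ∫ x, φ x ∂AddCircle.haarAddCircle).re = volume.real S * I := by
    have : ∫ x, φ x ∂AddCircle.haarAddCircle = (I : ℂ) := integral_ofReal
    rw [this, ← Complex.ofReal_mul, Complex.ofReal_re]
  rw [hlim] at ht
  filter_upwards [ht.eventually (lt_mem_nhds (show volume.real S * I / 2 < volume.real S * I by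
    have := mul_pos hV hIpos
    linarith))] with m hm
  have hre : (∫ θ in S, φ ((m * θ : ℝ) : AddCircle (1 : ℝ))) =
      ((∫ θ in S, b ((m * θ : ℝ) : AddCircle (1 : ℝ)) : ℝ) : ℂ) := integral_ofReal
  rw [Function.comp, hre, Complex.ofReal_re] at hm
  have hmE : MeasurableSet (nearOne m c) := (isOpen_nearOne m c).measurableSet
  have hle : ∫ θ in S, b ((m * θ : ℝ) : AddCircle (1 : ℝ)) ≤ volume.real (S ∩ nearOne m c) := by
    have hE : ∫ θ in S, (nearOne m c).indicator (fun _ => (1 : ℝ)) θ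
        = volume.real (S ∩ nearOne m c) := by
      rw [setIntegral_indicator hmE]
      simp
    rw [← hE]
    refine setIntegral_mono_on ?_ ?_ hS fun θ _ => ?_
    · exact Measure.integrableOn_of_bounded (M := 1) hfin
        (Continuous.aestronglyMeasurable (hbc.comp
          ((AddCircle.continuous_mk' 1).comp (by fun_prop))))
        (Eventually.of_forall fun θ => by rw [Real.norm_of_nonneg (hb0 _)]; exact hb1 _)
    · exact (integrableOn_const hfin).indicator hmE
    · by_cases hθ : θ ∈ nearOne m c
      · rw [indicator_of_mem hθ]; exact hb1 _
      · rw [indicator_of_notMem hθ]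
        refine max_le le_rfl ?_
        rw [sub_nonpos, one_le_div hc]
        have : c ≤ ‖Complex.exp (2 * Real.pi * Complex.I * m * θ) - 1‖ := not_lt.1 hθ
        rw [fourier_coe_apply]
        have e : 2 * (Real.pi : ℂ) * Complex.I * ((1 : ℤ) : ℂ) * ((m * θ : ℝ) : ℂ) / ((1 : ℝ) : ℂ) =
            2 * Real.pi * Complex.I * m * θ := by
          push_cast
          ring
        rwa [e]
  have := measureReal_sdiff_add_inter (μ := volume) (s := S) (t := nearOne m c) hmE hfin
  linarith

/-! ### Iterated antiderivatives of polynomials -/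

open Polynomial in
/-- The `t`-fold antiderivative of a polynomial, all integration constants being zero. -/
noncomputable def iterPrimitive (t : ℕ) (h : ℂ[X]) : ℂ[X] :=
  h.sum fun j b => monomial (j + t) (b * (j.factorial / (j + t).factorial : ℂ))

open Polynomial in
theorem iterPrimitive_zero (h : ℂ[X]) : iterPrimitive 0 h = h := by
  simp [iterPrimitive, Nat.factorial_ne_zero, Polynomial.sum_monomial_eq]

open Polynomial in
theorem derivative_iterPrimitive_succ (t : ℕ) (h : ℂ[X]) :
    derivative (iterPrimitive (t + 1) h) = iterPrimitive t h := by
  simp only [iterPrimitive, Polynomial.sum_def, map_sum, derivative_monomial]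
  refine Finset.sum_congr rfl fun j _ => ?_
  rw [← add_assoc, Nat.add_sub_cancel, Nat.factorial_succ]
  congr 1
  have h1 : ((j + t + 1 : ℕ) : ℂ) ≠ 0 := Nat.cast_ne_zero.2 (Nat.succ_ne_zero _)
  have h2 : ((j + t).factorial : ℂ) ≠ 0 := Nat.cast_ne_zero.2 (Nat.factorial_ne_zero _)
  push_cast at h1 ⊢
  field_simp

open Polynomial in
theorem iterate_derivative_iterPrimitive {n t : ℕ} (hnt : n ≤ t) (h : ℂ[X]) :
    derivative^[n] (iterPrimitive t h) = iterPrimitive (t - n) h := by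
  induction n with
  | zero => rfl
  | succ n ih =>
    rw [Function.iterate_succ_apply', ih (by omega), show t - n = (t - (n + 1)) + 1 by omega,
      derivative_iterPrimitive_succ]

open Polynomial in
theorem iterate_derivative_iterPrimitive_eq_zero {n t : ℕ} {h : ℂ[X]} (hn : t + h.natDegree < n) :
    derivative^[n] (iterPrimitive t h) = 0 := by
  rw [show n = (n - t) + t by omega, Function.iterate_add_apply,
    iterate_derivative_iterPrimitive le_rfl, Nat.sub_self, iterPrimitive_zero]
  exact iterate_derivative_eq_zero (by omega)

open Polynomial in
/-- The antiderivatives of a polynomial decay factorially on every disc. -/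
theorem exists_norm_eval_iterPrimitive_le (h : ℂ[X]) (R : ℝ) :
    ∃ H : ℝ, 0 ≤ H ∧ ∀ (t : ℕ) (w : ℂ), ‖w‖ ≤ R →
      ‖(iterPrimitive t h).eval w‖ ≤ H * (R ^ t / t.factorial) := by
  rcases lt_or_ge R 0 with hR | hR
  · exact ⟨0, le_rfl, fun t w hw => absurd (norm_nonneg w) (not_le.2 (hw.trans_lt hR))⟩
  refine ⟨∑ j ∈ h.support, ‖h.coeff j‖ * R ^ j, by positivity, fun t w hw => ?_⟩
  rw [iterPrimitive, Polynomial.sum_def, eval_finsetSum, Finset.sum_mul]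
  refine (norm_sum_le _ _).trans (Finset.sum_le_sum fun j _ => ?_)
  rw [eval_monomial, norm_mul, norm_mul, norm_pow, norm_div, Complex.norm_natCast,
    Complex.norm_natCast]
  have h1 : (j.factorial : ℝ) / (j + t).factorial ≤ 1 / t.factorial := by
    rw [div_le_div_iff₀ (by positivity) (by positivity), one_mul]
    exact_mod_cast Nat.le_of_dvd (Nat.factorial_pos _) (Nat.factorial_mul_factorial_dvd_factorial_add j t)
  calc ‖h.coeff j‖ * (j.factorial / (j + t).factorial) * ‖w‖ ^ (j + t)
      ≤ ‖h.coeff j‖ * (1 / t.factorial) * R ^ (j + t) := by gcongr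
    _ = ‖h.coeff j‖ * R ^ j * (R ^ t / t.factorial) := by rw [pow_add]; ring

/-- Factorials eventually beat every geometric factor. -/
theorem eventually_mul_pow_div_factorial_le (H X : ℝ) {η : ℝ} (hη : 0 < η) :
    ∀ᶠ t : ℕ in atTop, H * (X ^ t / t.factorial) ≤ η * (1 / 2) ^ t := by
  have := (FloorSemiring.tendsto_pow_div_factorial_atTop (2 * X)).const_mul H
  rw [mul_zero] at this
  filter_upwards [this.eventually (ge_mem_nhds hη)] with t ht
  rw [mul_pow] at ht
  have h2 : (0 : ℝ) < 2 ^ t := by positivity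
  rw [one_div, inv_pow, ← div_eq_mul_inv, le_div_iff₀ h2]
  linarith [show H * (X ^ t / t.factorial) * 2 ^ t = H * (2 ^ t * X ^ t / t.factorial) by ring]

/-! ### Divergence along progressions and elementary estimates -/

/-- Passing to an arithmetic progression of indices preserves divergence for antitone sequences. -/
theorem tendsto_sum_range_arith {a : ℕ → ℝ} (ha : Antitone a)
    (hsum : Tendsto (fun L : ℕ => ∑ n ∈ Finset.range L, a n) atTop atTop) (s : ℕ) {N : ℕ}
    (hN : 0 < N) :
    Tendsto (fun L : ℕ => ∑ l ∈ Finset.range L, a (s + N * l)) atTop atTop := by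
  -- By monotonicity, `N` consecutive terms sum to at most `N` times the first of them.
  have hblock : ∀ L, ∑ n ∈ Finset.range (N * L), a (s + n) ≤
      N * ∑ l ∈ Finset.range L, a (s + N * l) := by
    intro L
    induction L with
    | zero => simp
    | succ L ih =>
      rw [Nat.mul_succ, Finset.sum_range_add, Finset.sum_range_succ, mul_add]
      refine add_le_add ih ?_
      refine (Finset.sum_le_card_nsmul (Finset.range N) _ (a (s + N * L)) fun x _ =>
        ha (by omega)).trans ?_
      simp
  have h1 : Tendsto (fun L : ℕ => ∑ n ∈ Finset.range (N * L), a (s + n)) atTop atTop := by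
    have h2 : Tendsto (fun L : ℕ => s + N * L) atTop atTop :=
      tendsto_atTop_mono (fun L => by nlinarith : ∀ L, L ≤ s + N * L) tendsto_id
    refine (tendsto_atTop_add_const_left _ (-∑ n ∈ Finset.range s, a n)
      (hsum.comp h2)).congr fun L => ?_
    simp [Function.comp, Finset.sum_range_add]
  have h3 : Tendsto (fun L : ℕ => N * ∑ l ∈ Finset.range L, a (s + N * l)) atTop atTop :=
    tendsto_atTop_mono hblock h1
  exact (tendsto_const_mul_atTop_of_pos (by exact_mod_cast hN)).1 h3

theorem sum_range_ite_half_pow_le (L l : ℕ) :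
    ∑ i ∈ Finset.range L, (if l ≤ i then (1 / 2 : ℝ) ^ (i - l) else 0) ≤ 2 := by
  have h1 : ∑ i ∈ Finset.range L, (if l ≤ i then (1 / 2 : ℝ) ^ (i - l) else 0) ≤
      ∑ i ∈ Finset.range (l + L), (if l ≤ i then (1 / 2 : ℝ) ^ (i - l) else 0) :=
    Finset.sum_le_sum_of_subset_of_nonneg (Finset.range_mono (by omega)) fun i _ _ => by
      split_ifs <;> positivity
  refine h1.trans ?_
  rw [Finset.sum_range_add, Finset.sum_eq_zero, zero_add]
  · simpa using sum_geometric_two_le L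
  · intro x hx
    rw [if_neg (by simpa using hx)]

theorem norm_mul_sub_one_le {x c : ℝ} {u : ℂ} (hx1 : 1 ≤ x) (hx : x - 1 ≤ 2 * c) (hu : ‖u‖ = 1)
    (huc : ‖u - 1‖ ≤ c) : ‖(x : ℂ) * u - 1‖ ≤ 3 * c := by
  have h : (x : ℂ) * u - 1 = ((x - 1 : ℝ) : ℂ) * u + (u - 1) := by push_cast; ring
  rw [h]
  refine (norm_add_le _ _).trans ?_
  rw [norm_mul, hu, mul_one, Complex.norm_real, Real.norm_of_nonneg (by linarith)]
  linarith

/-- Look at the first index where `ρ` exceeds `r`; it is not `0`. Used to find the window that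
contains a given modulus. -/
theorem exists_mem_Ico_succ {ρ : ℕ → ℝ} {r : ℝ} {L : ℕ} (h0 : ρ 0 ≤ r) (hL : r < ρ L) :
    ∃ l < L, ρ l ≤ r ∧ r < ρ (l + 1) := by
  classical
  have hex : ∃ n, r < ρ n := ⟨L, hL⟩
  have hne : Nat.find hex ≠ 0 := fun h => by
    have := Nat.find_spec hex
    rw [h] at this
    linarith
  obtain ⟨l, hl⟩ := Nat.exists_eq_succ_of_ne_zero hne
  refine ⟨l, ?_, not_lt.1 (Nat.find_min hex (by omega)), ?_⟩
  · have := Nat.find_min' hex hL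
    omega
  · have := Nat.find_spec hex
    rwa [hl] at this

/-! ### One block: all moduli in an annulus -/

open Polynomial in
/-- A single polynomial, small together with its first derivatives, whose suitably normalised
higher derivatives approximate `h` for every modulus in `[A⁻¹, A]` and every argument in a set
`nearOne m c`, where `c` does not depend on the size constraints. -/
theorem exists_approx_on_annulus {k : ℕ → ℕ} (hpos : ∀ n, 0 < k n) (hk : StrictMono k)
    (hsum : Tendsto (fun N : ℕ => ∑ n ∈ Finset.range N, 1 / (k n : ℝ)) atTop atTop)
    (h : ℂ[X]) (R : ℝ) {A ε : ℝ} (hA : 1 ≤ A) (hε : 0 < ε) :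
    ∃ c : ℝ, 0 < c ∧ ∀ (M : ℕ) (η : ℝ), 0 < η → ∃ (p : ℂ[X]) (M' : ℕ), M < M' ∧
      (∀ n, M' ≤ n → derivative^[n] p = 0) ∧
      (∀ n ≤ M, ∀ w z : ℂ, ‖w‖ ≤ M → ‖z‖ ≤ M → ‖z ^ n * (derivative^[n] p).eval w‖ ≤ η) ∧
      ∀ r : ℝ, A⁻¹ ≤ r → r ≤ A → ∃ n, M ≤ k n ∧ k n < M' ∧ ∀ θ ∈ nearOne (k n) c, ∀ w : ℂ,
        ‖w‖ ≤ R → ‖((r : ℂ) * Complex.exp (2 * Real.pi * Complex.I * θ)) ^ k n *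
          (derivative^[k n] p).eval w - h.eval w‖ ≤ ε := by
  obtain ⟨H, hH0, hH⟩ := exists_norm_eval_iterPrimitive_le h R
  -- The bound `1` gives `e^c - 1 ≤ 2c`, hence `e^c ≤ 3`; the other bound makes the diagonal error
  -- `3cH` at most `ε/2`. Neither involves `M` or `η`.
  set c : ℝ := min 1 (ε / (6 * (H + 1))) with hc
  have hcpos : 0 < c := lt_min one_pos (by positivity)
  have hc1 : c ≤ 1 := min_le_left _ _
  have hcH : 3 * c * H ≤ ε / 2 := by
    have h1 : c ≤ ε / (6 * (H + 1)) := min_le_right _ _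
    rw [le_div_iff₀ (by positivity)] at h1
    nlinarith
  have hexpc : Real.exp c - 1 ≤ 2 * c := by
    have := Real.abs_exp_sub_one_le (x := c) (by rwa [abs_of_pos hcpos])
    rw [abs_of_pos hcpos] at this
    exact (le_abs_self _).trans this
  refine ⟨c, hcpos, fun M η hη => ?_⟩
  have hA0 : 0 < A := by linarith
  obtain ⟨H2, hH20, hH2⟩ := exists_norm_eval_iterPrimitive_le h (M : ℝ)
  set B : ℝ := (M + 1) * A with hB
  have hB1 : 1 ≤ B := by
    have : (0 : ℝ) ≤ M := Nat.cast_nonneg M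
    nlinarith
  obtain ⟨N₁, hN₁⟩ := eventually_atTop.1
    (eventually_mul_pow_div_factorial_le (B ^ M * H2) B (half_pos hη))
  obtain ⟨N₂, hN₂⟩ := eventually_atTop.1
    (eventually_mul_pow_div_factorial_le (3 * H) (A * R) (half_pos hε))
  -- Gaps between exponents exceed the degree, so lower terms are annihilated, and are at least
  -- `N₂`, so higher terms are in the range of factorial decay.
  set N : ℕ := N₂ + h.natDegree + 1 with hN
  -- With this start, at least `N₁ + l` antiderivatives of term `l` survive `n ≤ M`
  -- differentiations.
  set s : ℕ := M + N₁ with hs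
  set m : ℕ → ℕ := fun l => k (s + N * l) with hm
  have hmpos : ∀ l, 0 < m l := fun l => hpos _
  have hgap : ∀ l d, m l + N * d ≤ m (l + d) := fun l d => by
    have := hk.add_le_nat (N * d) (s + N * l)
    simp only [hm]
    rwa [mul_add, ← add_assoc, add_comm, add_comm (s + N * l)]
  have hgap' : ∀ l d, m l + d ≤ m (l + d) := fun l d =>
    le_trans (by nlinarith) (hgap l d)
  have hm0 : ∀ l, s + l ≤ m l := fun l =>
    le_trans (by nlinarith) (hk.le_apply (x := s + N * l))
  set σ : ℕ → ℝ := fun L => ∑ l ∈ Finset.range L, 1 / (m l : ℝ) with hσ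
  have hσt : Tendsto σ atTop atTop := by
    refine tendsto_sum_range_arith (a := fun n => 1 / (k n : ℝ)) (fun i j hij => ?_) hsum s
      (Nat.succ_pos _)
    exact one_div_le_one_div_of_le (by exact_mod_cast hpos i) (by exact_mod_cast hk.monotone hij)
  have hσmono : Monotone σ := monotone_nat_of_le_succ fun l => by
    simp only [hσ, Finset.sum_range_succ]
    have : (0 : ℝ) ≤ 1 / (m l : ℝ) := by positivity
    linarith
  -- The ratio of consecutive radii is `e^{c/m_l}`, so `(r/ρ_l)^{m_l}` stays in `[1, e^c]` on the
  -- `l`-th window.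
  set ρ : ℕ → ℝ := fun l => A⁻¹ * Real.exp (c * σ l) with hρ
  have hρ0 : ∀ l, 0 < ρ l := fun l => by positivity
  have hρmono : Monotone ρ := fun i j hij => by
    simp only [hρ]
    gcongr
    exact hσmono hij
  have hρ00 : ρ 0 = A⁻¹ := by simp [hρ, hσ]
  have hρA : ∀ l, A⁻¹ ≤ ρ l := fun l => hρ00 ▸ hρmono (Nat.zero_le l)
  have hρinv : ∀ l t : ℕ, (ρ l ^ t)⁻¹ ≤ A ^ t := fun l t => by
    rw [← inv_pow]
    exact pow_le_pow_left₀ (by have := hρ0 l; positivity) (inv_le_of_inv_le₀ hA0 (hρA l)) t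
  have hρt : Tendsto ρ atTop atTop :=
    (Real.tendsto_exp_atTop.comp (hσt.const_mul_atTop hcpos)).const_mul_atTop (by positivity)
  obtain ⟨L, hL⟩ := (hρt.eventually (eventually_gt_atTop A)).exists
  set p : ℂ[X] := ∑ l ∈ Finset.range L, C (((ρ l : ℂ) ^ m l)⁻¹) * iterPrimitive (m l) h with hp
  have hder : ∀ n, derivative^[n] p = ∑ l ∈ Finset.range L,
      C (((ρ l : ℂ) ^ m l)⁻¹) * derivative^[n] (iterPrimitive (m l) h) := fun n => by
    simp only [hp, iterate_derivative_sum, iterate_derivative_C_mul]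
  have hnρ : ∀ l n, ‖((ρ l : ℂ) ^ n)⁻¹‖ = (ρ l ^ n)⁻¹ := fun l n => by
    rw [norm_inv, norm_pow, Complex.norm_real, Real.norm_of_nonneg (hρ0 l).le]
  refine ⟨p, M + m L + h.natDegree + 1, by omega, fun n hn => ?_, fun n hn w z hw hz => ?_,
    fun r hr1 hr2 => ?_⟩
  · rw [hder]
    refine Finset.sum_eq_zero fun l hl => ?_
    have h1 := hgap' l (L - l)
    rw [Finset.mem_range] at hl
    rw [show l + (L - l) = L by omega] at h1
    rw [iterate_derivative_iterPrimitive_eq_zero (by omega), mul_zero]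
  · have hterm : ∀ l ∈ Finset.range L, ‖z ^ n * (C (((ρ l : ℂ) ^ m l)⁻¹) *
        derivative^[n] (iterPrimitive (m l) h)).eval w‖ ≤ η / 2 * (1 / 2) ^ l := by
      intro l _
      have hml := hm0 l
      have hnt : n + (m l - n) = m l := by omega
      rw [iterate_derivative_iterPrimitive (by omega), eval_mul, eval_C, norm_mul, norm_mul,
        norm_pow, hnρ]
      calc ‖z‖ ^ n * ((ρ l ^ m l)⁻¹ * ‖(iterPrimitive (m l - n) h).eval w‖)
          ≤ (M : ℝ) ^ n * (A ^ m l * (H2 * ((M : ℝ) ^ (m l - n) / (m l - n).factorial))) := by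
            gcongr
            · exact hρinv l _
            · exact hH2 _ w hw
        _ = (M * A) ^ n * H2 * ((M * A) ^ (m l - n) / (m l - n).factorial) := by
            rw [mul_pow, mul_pow, ← hnt, pow_add, Nat.add_sub_cancel_left]
            ring
        _ ≤ B ^ n * H2 * (B ^ (m l - n) / (m l - n).factorial) := by
            have : (M : ℝ) * A ≤ B := by rw [hB]; nlinarith
            gcongr
        _ ≤ B ^ M * H2 * (B ^ (m l - n) / (m l - n).factorial) := by gcongr
        _ ≤ η / 2 * (1 / 2) ^ (m l - n) := hN₁ _ (by omega)
        _ ≤ η / 2 * (1 / 2) ^ l := by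
            gcongr η / 2 * ?_
            exact pow_le_pow_of_le_one (by norm_num) (by norm_num) (by omega)
    rw [hder, eval_finsetSum, Finset.mul_sum]
    refine (norm_sum_le_of_le _ hterm).trans ?_
    rw [← Finset.mul_sum]
    have := sum_geometric_two_le L
    nlinarith
  · obtain ⟨l, hlL, hl1, hl2⟩ := exists_mem_Ico_succ (hρ00.trans_le hr1) (hr2.trans_lt hL)
    have hr0 : 0 < r := (hρ0 l).trans_le hl1
    have hmL : m l < m L := hk (by nlinarith)
    refine ⟨s + N * l, (by have := hm0 l; omega : M ≤ m l), (by omega : m l < _),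
      fun θ hθ w hw => ?_⟩
    change ‖_ ^ m l * (derivative^[m l] p).eval w - _‖ ≤ _
    change ‖Complex.exp (2 * Real.pi * Complex.I * (m l : ℕ) * θ) - 1‖ < c at hθ
    set u : ℂ := Complex.exp (2 * Real.pi * Complex.I * (m l : ℕ) * θ) with hu
    have hu1 : ‖u‖ = 1 := by
      rw [hu, show 2 * (Real.pi : ℂ) * Complex.I * (m l : ℕ) * θ =
        ((2 * Real.pi * m l * θ : ℝ) : ℂ) * Complex.I by push_cast; ring]
      exact Complex.norm_exp_ofReal_mul_I _
    have hzm : ((r : ℂ) * Complex.exp (2 * Real.pi * Complex.I * θ)) ^ m l = (r : ℂ) ^ m l * u := by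
      rw [mul_pow, ← Complex.exp_nat_mul, hu]
      congr 2
      ring
    have hratio1 : 1 ≤ (r / ρ l) ^ m l := one_le_pow₀ ((one_le_div (hρ0 l)).2 hl1)
    have hratio2 : (r / ρ l) ^ m l ≤ Real.exp c := by
      have h1 : r / ρ l ≤ Real.exp (c / m l) := by
        rw [div_le_iff₀ (hρ0 l)]
        refine hl2.le.trans (le_of_eq ?_)
        simp only [hρ, hσ, Finset.sum_range_succ]
        rw [mul_add, Real.exp_add]
        ring_nf
      have hm' : (m l : ℝ) ≠ 0 := by exact_mod_cast (hmpos l).ne'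
      calc (r / ρ l) ^ m l ≤ Real.exp (c / m l) ^ m l :=
            pow_le_pow_left₀ (div_nonneg hr0.le (hρ0 l).le) h1 _
        _ = Real.exp c := by rw [← Real.exp_nat_mul]; congr 1; field_simp
    have hrm : r ^ m l ≤ 3 * ρ l ^ m l := by
      rw [div_pow, div_le_iff₀ (pow_pos (hρ0 l) _)] at hratio2
      refine hratio2.trans ?_
      have := pow_pos (hρ0 l) (m l)
      gcongr
      linarith
    -- Terms `i < l` vanish, term `l` reproduces `h`, and terms `i > l` are geometrically small.
    have hterm : ∀ i ∈ Finset.range L, ‖(r : ℂ) ^ m l * u * (C (((ρ i : ℂ) ^ m i)⁻¹) *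
        derivative^[m l] (iterPrimitive (m i) h)).eval w - (if i = l then h.eval w else 0)‖ ≤
        ε / 2 * (if l ≤ i then (1 / 2 : ℝ) ^ (i - l) else 0) := by
      intro i _
      rcases lt_trichotomy i l with hil | rfl | hil
      · have h1 := hgap i (l - i)
        rw [show i + (l - i) = l by omega] at h1
        have h2 : N ≤ N * (l - i) := Nat.le_mul_of_pos_right _ (by omega)
        rw [iterate_derivative_iterPrimitive_eq_zero (by omega), if_neg hil.ne,
          if_neg (by omega)]
        simp
      · rw [iterate_derivative_iterPrimitive le_rfl, Nat.sub_self, iterPrimitive_zero, if_pos rfl,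
          if_pos le_rfl, Nat.sub_self, pow_zero, mul_one, eval_mul, eval_C]
        have hρc : (ρ i : ℂ) ≠ 0 := by exact_mod_cast (hρ0 i).ne'
        have h1 : (r : ℂ) ^ m i * u * (((ρ i : ℂ) ^ m i)⁻¹ * h.eval w) - h.eval w =
            ((((r / ρ i) ^ m i : ℝ) : ℂ) * u - 1) * h.eval w := by
          push_cast
          rw [div_pow]
          ring
        have h2 := hH 0 w hw
        rw [iterPrimitive_zero, pow_zero, Nat.factorial_zero, Nat.cast_one, div_one, mul_one] at h2
        rw [h1, norm_mul]
        have h3 := norm_mul_sub_one_le hratio1 (by linarith) hu1 hθ.le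
        calc _ ≤ 3 * c * H := mul_le_mul h3 h2 (norm_nonneg _) (by positivity)
          _ ≤ ε / 2 := hcH
      · have h1 := hgap l (i - l)
        rw [show l + (i - l) = i by omega] at h1
        have h2 : N ≤ N * (i - l) := Nat.le_mul_of_pos_right _ (by omega)
        have h3 : i - l ≤ N * (i - l) := Nat.le_mul_of_pos_left _ (by omega)
        have hmt : m l + (m i - m l) = m i := by omega
        rw [iterate_derivative_iterPrimitive (by omega), if_neg hil.ne', if_pos hil.le, sub_zero,
          eval_mul, eval_C, norm_mul, norm_mul, norm_mul, hu1, mul_one, hnρ, norm_pow,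
          Complex.norm_real, Real.norm_of_nonneg hr0.le]
        have hρi := hρ0 i
        have h4 : r ^ m l * (ρ i ^ m i)⁻¹ ≤ 3 * A ^ (m i - m l) := by
          have h5 : r ^ m l ≤ 3 * ρ i ^ m l := hrm.trans (by
            have := hρ0 l
            gcongr
            exact hρmono hil.le)
          rw [← hmt, pow_add, mul_inv, Nat.add_sub_cancel_left, ← mul_assoc]
          refine mul_le_mul ?_ (hρinv i _) (by positivity) (by norm_num)
          rwa [← div_eq_mul_inv, div_le_iff₀ (by positivity)]
        calc r ^ m l * ((ρ i ^ m i)⁻¹ * ‖(iterPrimitive (m i - m l) h).eval w‖)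
            = r ^ m l * (ρ i ^ m i)⁻¹ * ‖(iterPrimitive (m i - m l) h).eval w‖ := by ring
          _ ≤ 3 * A ^ (m i - m l) * (H * (R ^ (m i - m l) / (m i - m l).factorial)) :=
            mul_le_mul h4 (hH _ w hw) (norm_nonneg _) (by positivity)
          _ = 3 * H * ((A * R) ^ (m i - m l) / (m i - m l).factorial) := by
            rw [mul_pow]; ring
          _ ≤ ε / 2 * (1 / 2) ^ (m i - m l) := hN₂ _ (by omega)
          _ ≤ ε / 2 * (1 / 2) ^ (i - l) := by
            gcongr ε / 2 * ?_
            exact pow_le_pow_of_le_one (by norm_num) (by norm_num) (by omega)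
    have hsplit : ((r : ℂ) * Complex.exp (2 * Real.pi * Complex.I * θ)) ^ m l *
        (derivative^[m l] p).eval w - h.eval w = ∑ i ∈ Finset.range L, ((r : ℂ) ^ m l * u *
        (C (((ρ i : ℂ) ^ m i)⁻¹) * derivative^[m l] (iterPrimitive (m i) h)).eval w -
        (if i = l then h.eval w else 0)) := by
      rw [Finset.sum_sub_distrib, Finset.sum_ite_eq', if_pos (Finset.mem_range.2 hlL), hder, hzm,
        eval_finsetSum, Finset.mul_sum]
    rw [hsplit]
    refine (norm_sum_le_of_le _ hterm).trans ?_
    rw [← Finset.mul_sum]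
    have := sum_range_ite_half_pow_le L l
    nlinarith

/-! ### Series of polynomials and exhaustion in measure -/

open Polynomial in
theorem iteratedDeriv_polynomial_eval (n : ℕ) (p : ℂ[X]) :
    iteratedDeriv n (fun w => p.eval w) = fun w => (derivative^[n] p).eval w := by
  induction n with
  | zero => rfl
  | succ n ih =>
    rw [iteratedDeriv_succ, ih, Function.iterate_succ_apply']
    ext w
    exact Polynomial.deriv _

open Polynomial in
/-- A sufficiently small series of polynomials converges to an entire function and may be
differentiated termwise. -/
theorem exists_differentiable_hasDerivatives {p : ℕ → ℂ[X]}
    (hp : ∀ (i : ℕ) (w : ℂ), ‖w‖ ≤ i → ‖(p i).eval w‖ ≤ (1 / 2) ^ i) :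
    ∃ f : ℂ → ℂ, Differentiable ℂ f ∧ ∀ (n : ℕ) (w : ℂ),
      Tendsto (fun N : ℕ => ∑ i ∈ Finset.range N, (derivative^[n] (p i)).eval w) atTop
        (𝓝 (iteratedDeriv n f w)) := by
  set s : ℕ → ℂ → ℂ := fun N w => (∑ i ∈ Finset.range N, p i).eval w with hs
  set f : ℂ → ℂ := fun w => ∑' i, (p i).eval w with hf
  have h0 : TendstoLocallyUniformlyOn s f atTop univ := by
    rw [tendstoLocallyUniformlyOn_iff_forall_isCompact isOpen_univ]
    intro K _ hK
    obtain ⟨C, hC⟩ := hK.isBounded.exists_norm_le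
    have := tendstoUniformlyOn_tsum_nat_eventually (f := fun i w => (p i).eval w) (s := K)
      summable_geometric_two (by
        filter_upwards [eventually_ge_atTop ⌈C⌉₊] with i hi w hw
        exact hp i w ((hC w hw).trans ((Nat.le_ceil C).trans (by exact_mod_cast hi))))
    simpa [hs, eval_finsetSum] using this
  -- Weierstrass: locally uniform limits of holomorphic functions commute with differentiation.
  have hn : ∀ n, TendstoLocallyUniformlyOn (fun N => iteratedDeriv n (s N)) (iteratedDeriv n f)
      atTop univ := by
    intro n
    induction n with
    | zero => simpa using h0
    | succ n ih =>
      simp only [iteratedDeriv_succ]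
      refine ih.deriv (Eventually.of_forall fun N => ?_) isOpen_univ
      simp only [hs, iteratedDeriv_polynomial_eval]
      exact (Polynomial.differentiable _).differentiableOn
  refine ⟨f, ?_, fun n w => ?_⟩
  · rw [← differentiableOn_univ]
    exact h0.differentiableOn (Eventually.of_forall fun N =>
      (Polynomial.differentiable _).differentiableOn) isOpen_univ
  · refine ((hn n).tendsto_at (mem_univ w)).congr fun N => ?_
    rw [hs, iteratedDeriv_polynomial_eval, iterate_derivative_sum]
    exact eval_finsetSum _ _ _

/-- Each `E b` leaves at most the fraction `q` of what its predecessors missed, so the remainder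
decays like `q^b`. -/
theorem measure_diff_iUnion_eq_zero {E : ℕ → Set ℝ} {q : ℝ} (hq0 : 0 ≤ q) (hq1 : q < 1)
    {S : Set ℝ} (hS : volume S ≠ ⊤)
    (h : ∀ b : ℕ, volume.real ((S \ ⋃ a ∈ Finset.range b, E a) \ E b) ≤
      q * volume.real (S \ ⋃ a ∈ Finset.range b, E a)) :
    volume (S \ ⋃ b, E b) = 0 := by
  have hle : ∀ b : ℕ, volume.real (S \ ⋃ a ∈ Finset.range b, E a) ≤ q ^ b * volume.real S := by
    intro b
    induction b with
    | zero => simp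
    | succ b ih =>
      have hb : (S \ ⋃ a ∈ Finset.range (b + 1), E a) =
          (S \ ⋃ a ∈ Finset.range b, E a) \ E b := by
        rw [Finset.range_add_one, Finset.set_biUnion_insert, union_comm, ← Set.sdiff_sdiff]
      rw [hb, pow_succ']
      calc _ ≤ q * volume.real (S \ ⋃ a ∈ Finset.range b, E a) := h b
        _ ≤ q * (q ^ b * volume.real S) := by gcongr
        _ = _ := by ring
  have ht : Tendsto (fun b : ℕ => q ^ b * volume.real S) atTop (𝓝 0) := by
    simpa using (tendsto_pow_atTop_nhds_zero_of_lt_one hq0 hq1).mul_const (volume.real S)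
  have h0 : volume.real (S \ ⋃ b, E b) ≤ 0 := ge_of_tendsto' ht fun b =>
    (measureReal_mono (sdiff_subset_sdiff_right (iUnion₂_subset fun a _ => subset_iUnion E a))
      (measure_ne_top_of_subset sdiff_subset hS)).trans (hle b)
  exact (measureReal_eq_zero_iff (measure_ne_top_of_subset sdiff_subset hS)).1
    (le_antisymm h0 measureReal_nonneg)

/-! ### Gluing the blocks -/

open Polynomial in
/-- The building block of the hypercyclic function: besides approximating `h`, its derivatives do so
on sets of arguments that are nearly independent of all sets `nearOne m c` with `m < M`. -/
theorem exists_approx_nearly_independent {k : ℕ → ℕ} (hpos : ∀ n, 0 < k n) (hk : StrictMono k)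
    (hsum : Tendsto (fun N : ℕ => ∑ n ∈ Finset.range N, 1 / (k n : ℝ)) atTop atTop)
    (h : ℂ[X]) (R : ℝ) {A ε : ℝ} (hA : 1 ≤ A) (hε : 0 < ε) :
    ∃ c q : ℝ, 0 ≤ q ∧ q < 1 ∧ ∀ M : ℕ, ∃ (p : ℂ[X]) (M' : ℕ), M < M' ∧
      (∀ n, M' ≤ n → derivative^[n] p = 0) ∧
      (∀ n ≤ M, ∀ w z : ℂ, ‖w‖ ≤ M → ‖z‖ ≤ M →
        ‖z ^ n * (derivative^[n] p).eval w‖ ≤ (1 / 2) ^ M) ∧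
      ∀ r : ℝ, A⁻¹ ≤ r → r ≤ A → ∃ n, M ≤ k n ∧ k n < M' ∧
        (∀ θ ∈ nearOne (k n) c, ∀ w : ℂ, ‖w‖ ≤ R →
          ‖((r : ℂ) * Complex.exp (2 * Real.pi * Complex.I * θ)) ^ k n *
            (derivative^[k n] p).eval w - h.eval w‖ ≤ ε) ∧
        ∀ F ⊆ Finset.range M,
          volume.real ((Ico (0 : ℝ) 1 \ ⋃ m ∈ F, nearOne m c) \ nearOne (k n) c) ≤
            q * volume.real (Ico (0 : ℝ) 1 \ ⋃ m ∈ F, nearOne m c) := by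
  obtain ⟨c, hc, H⟩ := exists_approx_on_annulus hpos hk hsum h R hA hε
  obtain ⟨q, hq0, hq1, hq⟩ := exists_measureReal_diff_nearOne_le hc
  refine ⟨c, q, hq0, hq1, fun M => ?_⟩
  -- The exponents used earlier depend on `r`, so every possible set `F` is allowed; there are
  -- finitely many below `M`, hence one threshold serves all.
  have hev : ∀ᶠ m : ℕ in atTop, ∀ F ∈ (Finset.range M).powerset,
      volume.real ((Ico (0 : ℝ) 1 \ ⋃ m ∈ F, nearOne m c) \ nearOne m c) ≤
        q * volume.real (Ico (0 : ℝ) 1 \ ⋃ m ∈ F, nearOne m c) := by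
    rw [Filter.eventually_all_finset]
    intro F _
    refine hq _ (measurableSet_Ico.diff (Finset.measurableSet_biUnion _ fun m _ =>
      (isOpen_nearOne m c).measurableSet)) (measure_ne_top_of_subset sdiff_subset (by simp))
  obtain ⟨N, hN⟩ := eventually_atTop.1 hev
  obtain ⟨p, M', hM', hz, hs, ha⟩ := H (max M N) ((1 / 2) ^ M) (by positivity)
  refine ⟨p, M', (le_max_left _ _).trans_lt hM', hz, fun n hn w z hw hz => ?_, fun r hr1 hr2 => ?_⟩
  · have hMN : (M : ℝ) ≤ (max M N : ℕ) := by exact_mod_cast le_max_left _ _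
    exact hs n (hn.trans (le_max_left _ _)) w z (hw.trans hMN) (hz.trans hMN)
  · obtain ⟨n, hn1, hn2, hn3⟩ := ha r hr1 hr2
    exact ⟨n, (le_max_left _ _).trans hn1, hn2, hn3, fun F hF =>
      hN _ ((le_max_right _ _).trans hn1) F (Finset.mem_powerset.2 hF)⟩

open Polynomial in
/-- For every sequence of polynomials there is an entire function whose normalised derivatives of
orders `k n` follow the sequence, for every modulus and almost every argument. -/
theorem exists_entire_approx {k : ℕ → ℕ} (hpos : ∀ n, 0 < k n) (hk : StrictMono k)
    (hsum : Tendsto (fun N : ℕ => ∑ n ∈ Finset.range N, 1 / (k n : ℝ)) atTop atTop)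
    (P : ℕ → ℂ[X]) :
    ∃ f : ℂ → ℂ, Differentiable ℂ f ∧ ∀ r : ℝ, 0 < r →
      ∀ᵐ θ : ℝ ∂volume.restrict (Ico 0 1), ∀ᶠ j : ℕ in atTop, ∃ n, ∀ w : ℂ, ‖w‖ ≤ j + 1 →
        ‖((r : ℂ) * Complex.exp (2 * Real.pi * Complex.I * θ)) ^ k n *
          iteratedDeriv (k n) f w - (P j).eval w‖ ≤ 1 / (j + 1) + (1 / 2) ^ j := by
  choose c q hq0 hq1 p M' hM' hzero hsmall happ using fun j : ℕ =>
    exists_approx_nearly_independent hpos hk hsum (P j) (j + 1) (A := j + 1) (ε := 1 / (j + 1))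
      (by linarith [(Nat.cast_nonneg j : (0 : ℝ) ≤ j)]) Nat.one_div_pos_of_nat
  -- Stage `i` treats the target with index `(Nat.unpair i).1` and uses orders in `[M i, M (i +
  -- 1))`.
  set M : ℕ → ℕ := fun i => Nat.rec 1 (fun i x => M' (Nat.unpair i).1 x) i with hM
  have hMs : ∀ i, M (i + 1) = M' (Nat.unpair i).1 (M i) := fun i => rfl
  have hMlt : StrictMono M := strictMono_nat_of_lt_succ fun i => by rw [hMs]; exact hM' _ _
  have hMi : ∀ i, i + 1 ≤ M i := fun i => by
    induction i with
    | zero => exact le_rfl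
    | succ i ih => have := hMlt (Nat.lt_add_one i); omega
  have hhalf : ∀ i, ((1 : ℝ) / 2) ^ M i ≤ (1 / 2) ^ i := fun i =>
    pow_le_pow_of_le_one (by norm_num) (by norm_num) (by have := hMi i; omega)
  set g : ℕ → ℂ[X] := fun i => p (Nat.unpair i).1 (M i) with hg
  have hgsmall : ∀ i, ∀ n ≤ M i, ∀ w z : ℂ, ‖w‖ ≤ M i → ‖z‖ ≤ M i →
      ‖z ^ n * (derivative^[n] (g i)).eval w‖ ≤ (1 / 2) ^ i := fun i n hn w z hw hz =>
    (hsmall _ (M i) n hn w z hw hz).trans (hhalf i)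
  obtain ⟨f, hf, hlim⟩ := exists_differentiable_hasDerivatives (p := g) fun i w hw => by
    have h1 : (i : ℝ) ≤ M i := by exact_mod_cast (Nat.le_succ i).trans (hMi i)
    simpa using hgsmall i 0 (Nat.zero_le _) w 0 (hw.trans h1) (by simp)
  refine ⟨f, hf, fun r hr => ?_⟩
  have hj : ∀ᶠ j : ℕ in atTop, ((j : ℝ) + 1)⁻¹ ≤ r ∧ r ≤ j + 1 := by
    filter_upwards [eventually_ge_atTop ⌈r⌉₊, eventually_ge_atTop ⌈r⁻¹⌉₊] with j h1 h2
    have h3 : r ≤ j := (Nat.le_ceil r).trans (by exact_mod_cast h1)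
    have h4 : r⁻¹ ≤ j := (Nat.le_ceil r⁻¹).trans (by exact_mod_cast h2)
    exact ⟨inv_le_of_inv_le₀ hr (by linarith), by linarith⟩
  obtain ⟨j₀, hj₀⟩ := eventually_atTop.1 hj
  suffices hae : ∀ j : ℕ, j₀ ≤ j → ∀ᵐ θ : ℝ ∂volume.restrict (Ico 0 1), ∃ n, ∀ w : ℂ,
      ‖w‖ ≤ j + 1 → ‖((r : ℂ) * Complex.exp (2 * Real.pi * Complex.I * θ)) ^ k n *
        iteratedDeriv (k n) f w - (P j).eval w‖ ≤ 1 / (j + 1) + (1 / 2) ^ j by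
    have hall : ∀ᵐ θ : ℝ ∂volume.restrict (Ico 0 1), ∀ j : ℕ, j₀ ≤ j → ∃ n, ∀ w : ℂ,
        ‖w‖ ≤ j + 1 → ‖((r : ℂ) * Complex.exp (2 * Real.pi * Complex.I * θ)) ^ k n *
          iteratedDeriv (k n) f w - (P j).eval w‖ ≤ 1 / (j + 1) + (1 / 2) ^ j :=
      ae_all_iff.2 fun j => by
        by_cases h : j₀ ≤ j
        · filter_upwards [hae j h] with θ hθ _ using hθ
        · exact Eventually.of_forall fun θ h' => absurd h' h
    filter_upwards [hall] with θ hθ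
    filter_upwards [eventually_ge_atTop j₀] with j hj' using hθ j hj'
  intro j hjj
  obtain ⟨hr1, hr2⟩ := hj₀ j hjj
  choose n hn1 hn2 hn3 hn4 using fun b : ℕ => happ j (M (Nat.pair j b)) r hr1 hr2
  have hMpair : ∀ b, M' j (M (Nat.pair j b)) = M (Nat.pair j b + 1) := fun b => by
    rw [hMs, Nat.unpair_pair]
  have hgpair : ∀ b, p j (M (Nat.pair j b)) = g (Nat.pair j b) := fun b => by
    simp only [hg, Nat.unpair_pair]
  have hnull := measure_diff_iUnion_eq_zero (E := fun b => nearOne (k (n b)) (c j))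
    (hq0 j) (hq1 j) (S := Ico (0 : ℝ) 1) (by simp) fun b => by
      -- Earlier rounds for the same target used orders below the current start, as `Nat.pair j` is
      -- increasing.
      have hF : (Finset.range b).image (fun a => k (n a)) ⊆ Finset.range (M (Nat.pair j b)) := by
        intro x hx
        obtain ⟨a, ha, rfl⟩ := Finset.mem_image.1 hx
        have h1 := hn2 a
        rw [hMpair] at h1
        exact Finset.mem_range.2 (h1.trans_le (hMlt.monotone
          (Nat.succ_le_of_lt (Nat.pair_lt_pair_right j (Finset.mem_range.1 ha)))))
      have := hn4 b _ hF
      rwa [Finset.set_biUnion_finset_image] at this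
  rw [ae_restrict_iff' measurableSet_Ico]
  filter_upwards [measure_eq_zero_iff_ae_notMem.1 hnull] with θ hθ hθI
  obtain ⟨b, hb⟩ : ∃ b, θ ∈ nearOne (k (n b)) (c j) := by
    simpa [hθI.1, hθI.2] using hθ
  refine ⟨n b, fun w hw => ?_⟩
  set z : ℂ := (r : ℂ) * Complex.exp (2 * Real.pi * Complex.I * θ) with hz
  have hznorm : ‖z‖ = r := by
    rw [hz, norm_mul, Complex.norm_real, Real.norm_of_nonneg hr.le,
      show 2 * (Real.pi : ℂ) * Complex.I * θ = ((2 * Real.pi * θ : ℝ) : ℂ) * Complex.I by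
        push_cast; ring, Complex.norm_exp_ofReal_mul_I, mul_one]
  set i : ℕ := Nat.pair j b with hi
  have hji : j ≤ i := Nat.left_le_pair j b
  have hki : M i ≤ k (n b) := hn1 b
  have hki' : k (n b) < M (i + 1) := hMpair b ▸ hn2 b
  have hpow : ∀ l, i < l → ((1 : ℝ) / 2) ^ l = (1 / 2) ^ (l - (i + 1)) * (1 / 2) ^ (i + 1) :=
    fun l hl => by rw [← pow_add, Nat.sub_add_cancel hl]
  -- Stages before `i` are annihilated, stage `i` approximates the target, and later ones add at
  -- most `2 (1/2)^{i+1} = (1/2)^i` in total.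
  have hterm : ∀ l, ‖z ^ k (n b) * (derivative^[k (n b)] (g l)).eval w -
      (if l = i then (P j).eval w else 0)‖ ≤ (if l = i then 1 / ((j : ℝ) + 1) else 0) +
        (if i + 1 ≤ l then (1 / 2 : ℝ) ^ (l - (i + 1)) else 0) * (1 / 2) ^ (i + 1) := by
    intro l
    rcases lt_trichotomy l i with hl | rfl | hl
    · have h1 : M (l + 1) ≤ M i := hMlt.monotone hl
      rw [hzero (Nat.unpair l).1 (M l) (k (n b)) (by rw [← hMs]; omega), if_neg hl.ne,
        if_neg hl.ne, if_neg (by omega)]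
      simp
    · have h1 := hn3 b θ hb w hw
      rw [hgpair] at h1
      simpa using h1
    · have h1 : M (i + 1) ≤ M l := hMlt.monotone hl
      have h2 : (j : ℝ) + 1 ≤ M l := by
        have := hMi l
        exact_mod_cast (by omega : j + 1 ≤ M l)
      rw [if_neg hl.ne', if_neg hl.ne', if_pos (Nat.succ_le_of_lt hl), sub_zero, zero_add,
        ← hpow l hl]
      exact hgsmall l _ (by omega) w z (hw.trans h2) (by rw [hznorm]; exact hr2.trans h2)
  have htend : Tendsto (fun N : ℕ => ‖z ^ k (n b) * (∑ l ∈ Finset.range N,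
      (derivative^[k (n b)] (g l)).eval w) - (P j).eval w‖) atTop
      (𝓝 ‖z ^ k (n b) * iteratedDeriv (k (n b)) f w - (P j).eval w‖) :=
    (((hlim (k (n b)) w).const_mul _).sub_const _).norm
  refine le_of_tendsto htend ?_
  filter_upwards [eventually_gt_atTop i] with N hN
  have hsplit : z ^ k (n b) * (∑ l ∈ Finset.range N, (derivative^[k (n b)] (g l)).eval w) -
      (P j).eval w = ∑ l ∈ Finset.range N, (z ^ k (n b) * (derivative^[k (n b)] (g l)).eval w -
        (if l = i then (P j).eval w else 0)) := by
    rw [Finset.sum_sub_distrib, Finset.sum_ite_eq', if_pos (Finset.mem_range.2 hN), Finset.mul_sum]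
  rw [hsplit]
  refine (norm_sum_le_of_le _ fun l _ => hterm l).trans ?_
  rw [Finset.sum_add_distrib, Finset.sum_ite_eq', if_pos (Finset.mem_range.2 hN), ← Finset.sum_mul]
  have h1 := sum_range_ite_half_pow_le N (i + 1)
  have h2 : ((1 : ℝ) / 2) ^ i ≤ (1 / 2) ^ j := pow_le_pow_of_le_one (by norm_num) (by norm_num) hji
  have h3 : (0 : ℝ) < (1 / 2) ^ i := by positivity
  rw [pow_succ (1 / 2 : ℝ) i]
  nlinarith

/-! ### From approximation to density in the space of entire functions -/

theorem continuous_dilationOp (w : ℂ) : Continuous (dilationOp w) :=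
  Continuous.subtype_mk ((ContinuousMap.continuous_precomp
    ⟨fun z : ℂ => w * z, by fun_prop⟩).comp continuous_subtype_val) _

theorem surjective_dilationOp {w : ℂ} (hw : w ≠ 0) : Function.Surjective (dilationOp w) := fun g =>
  ⟨dilationOp w⁻¹ g, by
    ext z
    change g.1 (w⁻¹ * (w * z)) = g.1 z
    rw [inv_mul_cancel_left₀ hw]⟩

theorem differentiationOp_pow_apply (n : ℕ) (g : entireFunctions) (w : ℂ) :
    ((differentiationOp ^ n) g).1 w = iteratedDeriv n g.1 w := by
  induction n generalizing w with
  | zero => rfl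
  | succ n ih =>
    rw [pow_succ', iteratedDeriv_succ]
    change deriv ((differentiationOp ^ n) g).1 w = _
    rw [funext ih]

theorem dilatedDerivOp_apply (n : ℕ) (z : ℂ) (g : entireFunctions) :
    dilatedDerivOp n z g = dilationOp z (z ^ n • (differentiationOp ^ n) g) := by
  ext w
  change ((differentiationOp ^ n) (dilationOp z g)).1 w =
    z ^ n * ((differentiationOp ^ n) g).1 (z * w)
  rw [differentiationOp_pow_apply, differentiationOp_pow_apply]
  change iteratedDeriv n (fun w => g.1 (z * w)) w = _
  rw [iteratedDeriv_comp_const_mul (entireFunctions_differentiable g).contDiff]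

/-- To be a dense orbit, it suffices that the normalised derivatives are dense. -/
theorem mem_hypercyclicVectors_of_denseRange {k : ℕ → ℕ} {z : ℂ} (hz : z ≠ 0) {g : entireFunctions}
    (h : DenseRange fun n => z ^ k n • (differentiationOp ^ k n) g) :
    g ∈ hypercyclicVectors fun n => ⇑(dilatedDerivOp (k n) z) := by
  change DenseRange _
  have := (surjective_dilationOp hz).denseRange.comp h (continuous_dilationOp z)
  simpa only [Function.comp_def, ← dilatedDerivOp_apply] using this

theorem tendsto_entireFunctions_of_norm_sub_le {u : ℕ → entireFunctions} {g : entireFunctions}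
    {R δ : ℕ → ℝ} (hR : Tendsto R atTop atTop) (hδ : Tendsto δ atTop (𝓝 0))
    (h : ∀ᶠ b in atTop, ∀ w : ℂ, ‖w‖ ≤ R b → ‖(u b).1 w - g.1 w‖ ≤ δ b) :
    Tendsto u atTop (𝓝 g) := by
  rw [tendsto_subtype_rng, ContinuousMap.tendsto_iff_forall_isCompact_tendstoUniformlyOn]
  intro K hK
  obtain ⟨C, hC⟩ := hK.isBounded.exists_norm_le
  rw [Metric.tendstoUniformlyOn_iff]
  intro ε hε
  filter_upwards [h, hR.eventually (eventually_ge_atTop C), hδ.eventually (gt_mem_nhds hε)]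
    with b hb hbR hbδ w hw
  rw [dist_comm, dist_eq_norm]
  exact (hb w ((hC w hw).trans hbR)).trans_lt hbδ

-- Partial sums of the Taylor series at `0`, which converges uniformly on every disc.
open Polynomial in
theorem exists_polynomial_approx {g : ℂ → ℂ} (hg : Differentiable ℂ g) (R : ℝ) {ε : ℝ}
    (hε : 0 < ε) : ∃ P : ℂ[X], ∀ w : ℂ, ‖w‖ ≤ R → ‖P.eval w - g w‖ ≤ ε := by
  set a : FormalMultilinearSeries ℂ ℂ ℂ := cauchyPowerSeries g 0 1
  have hps : HasFPowerSeriesOnBall g a 0 ⊤ := by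
    simpa using hg.hasFPowerSeriesOnBall 0 (R := 1) one_pos
  have hu := hps.tendstoUniformlyOn' (r' := (|R| + 1).toNNReal) ENNReal.coe_lt_top
  obtain ⟨N, hN⟩ := (Metric.tendstoUniformlyOn_iff.1 hu ε hε).exists
  refine ⟨∑ i ∈ Finset.range N, monomial i (a.coeff i), fun w hw => ?_⟩
  have h1 := hN w (by
    rw [Metric.mem_ball, dist_zero_right, Real.coe_toNNReal _ (by positivity)]
    linarith [le_abs_self R])
  rw [dist_comm, dist_eq_norm] at h1
  have h2 : a.partialSum N (w - 0) =
      (∑ i ∈ Finset.range N, monomial i (a.coeff i)).eval w := by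
    simp [FormalMultilinearSeries.partialSum, eval_finsetSum, mul_comm]
  rw [← h2]
  exact h1.le

theorem isFullMeasure_of_ae {J : Set ℂ} (h0 : J ⊆ {0}ᶜ)
    (h : ∀ r : ℝ, 0 < r → ∀ᵐ θ : ℝ ∂volume.restrict (Ico 0 1),
      (r : ℂ) * Complex.exp (2 * Real.pi * Complex.I * θ) ∈ J) : IsFullMeasure J := by
  refine ⟨h0, fun r hr => ?_⟩
  have hae : arcs J r =ᵐ[volume] Ico (0 : ℝ) 1 := by
    have := h r hr
    rw [ae_restrict_iff' measurableSet_Ico] at this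
    filter_upwards [this] with θ hθ
    refine propext ⟨fun hx => hx.1, fun hx => ⟨hx, _, hθ hx, rfl⟩⟩
  exact ⟨measurableSet_Ico.nullMeasurableSet.congr hae.symm, by rw [measure_congr hae]; simp⟩

theorem theorem1p4 (k : ℕ → ℕ) (hpos : ∀ n, 0 < k n) (hk : StrictMono k)
    (hsum : Tendsto (fun N : ℕ => ∑ n ∈ Finset.range N, 1 / (k n : ℝ)) atTop atTop) :
    ∃ J : Set ℂ, IsFullMeasure J ∧
      (⋂ z ∈ J, hypercyclicVectors fun n => ⇑(dilatedDerivOp (k n) z)).Nonempty := by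
  have : SecondCountableTopology entireFunctions :=
    TopologicalSpace.Subtype.secondCountableTopology (entireFunctions : Set C(ℂ, ℂ))
  set d : ℕ → entireFunctions := TopologicalSpace.denseSeq entireFunctions with hd
  -- Via `Nat.unpair`, each member of the dense sequence is a target infinitely often, on growing
  -- discs and with errors tending to zero.
  choose P hP using fun j : ℕ => exists_polynomial_approx
    (entireFunctions_differentiable (d (Nat.unpair j).1)) (j + 1) (Nat.one_div_pos_of_nat (n := j))
  obtain ⟨f, hf, happ⟩ := exists_entire_approx hpos hk hsum P
  set F : entireFunctions := ⟨⟨f, hf.continuous⟩, hf⟩ with hF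
  -- `J` is the set of all good `z`; only its trace on each circle, up to null sets, has to be
  -- controlled.
  refine ⟨{z | z ≠ 0 ∧ F ∈ hypercyclicVectors fun n => ⇑(dilatedDerivOp (k n) z)},
    isFullMeasure_of_ae (fun z hz => hz.1) fun r hr => ?_, F, mem_iInter₂.2 fun z hz => hz.2⟩
  filter_upwards [happ r hr] with θ hθ
  set z : ℂ := (r : ℂ) * Complex.exp (2 * Real.pi * Complex.I * θ) with hz
  have hz0 : z ≠ 0 := mul_ne_zero (by exact_mod_cast hr.ne') (Complex.exp_ne_zero _)
  refine ⟨hz0, mem_hypercyclicVectors_of_denseRange hz0 ?_⟩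
  refine dense_closure.1 ((TopologicalSpace.denseRange_denseSeq entireFunctions).mono ?_)
  rintro _ ⟨a, rfl⟩
  obtain ⟨j₀, hj₀⟩ := eventually_atTop.1 hθ
  choose! n hn using hj₀
  have hpair : Tendsto (fun b => Nat.pair a b) atTop atTop :=
    tendsto_atTop_mono (fun b => Nat.right_le_pair a b) tendsto_id
  refine mem_closure_of_tendsto (f := fun b : ℕ => z ^ k (n (Nat.pair a b)) •
    (differentiationOp ^ k (n (Nat.pair a b))) F) (b := atTop) ?_
    (Eventually.of_forall fun b => mem_range_self (n (Nat.pair a b)))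
  have hδ : Tendsto (fun j : ℕ => 1 / ((j : ℝ) + 1) + (1 / 2) ^ j + 1 / ((j : ℝ) + 1)) atTop
      (𝓝 0) := by
    have h1 := tendsto_one_div_add_atTop_nhds_zero_nat (𝕜 := ℝ)
    have h2 := tendsto_pow_atTop_nhds_zero_of_lt_one (r := (1 / 2 : ℝ)) (by norm_num) (by norm_num)
    simpa using (h1.add h2).add h1
  refine tendsto_entireFunctions_of_norm_sub_le
    (tendsto_natCast_atTop_atTop.comp hpair) (hδ.comp hpair) ?_
  filter_upwards [hpair.eventually (eventually_ge_atTop j₀)] with b hb w hw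
  have hw' : ‖w‖ ≤ (Nat.pair a b : ℝ) + 1 := by
    have : ‖w‖ ≤ (Nat.pair a b : ℝ) := hw
    linarith
  have h1 := hn _ hb w hw'
  have h2 := hP (Nat.pair a b) w hw'
  rw [Nat.unpair_pair] at h2
  have h3 : (z ^ k (n (Nat.pair a b)) • (differentiationOp ^ k (n (Nat.pair a b))) F).1 w =
      z ^ k (n (Nat.pair a b)) * iteratedDeriv (k (n (Nat.pair a b))) f w :=
    congrArg (z ^ k (n (Nat.pair a b)) * ·) (differentiationOp_pow_apply _ F w)
  rw [h3]
  refine (norm_sub_le_norm_sub_add_norm_sub _ ((P (Nat.pair a b)).eval w) _).trans ?_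
  exact add_le_add h1 h2
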